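/- Let $X=(X_t)_{t\ge 0}$ be a real-valued Lévy process (started at $0$, with stationary and independent increments and almost surely càdlàg paths) with characteristic triplet $(a,\sigma,\nu)$, that is, $\nu$ is a Lévy measure and $$\mathbb E[e^{izX_1}]=\exp\Big(iaz-\tfrac{\sigma^2z^2}{2}+\int_{\mathbb R}\big(e^{izx}-1-izx\,\mathbf 1_{\{|x|\le 1\}}\big)\,\nu(dx)\Big),\qquad z\in\mathbb R.$$ Assume that $\mathbb E[e^{X_t}]<\infty$ for all $t\ge 0$ and that $\sigma>0$, and set $f(t,k)=\mathbb E[(e^{X_t}-k)^+]$, where $(x)^+=\max\{x,0\}$. Then for every $t>0$ the random variable $X_t$ has a (unique) continuous density $p_t$ with respect to Lebesgue measure, and for all $t>0$ and $k>0$ the function $f(t,\cdot)$ is twice differentiable at $k$ with $$\frac{\partial f(t,k)}{\partial k}=-\mathbb P(e^{X_t}>k)\qquad\text{and}\qquad \frac{\partial^2 f(t,k)}{\partial k^2}=\frac{p_t(\log k)}{k}.$$ Moreover, for every fixed $k>0$, both $\frac{\partial f(t,k)}{\partial k}$ and $\frac{\partial^2 f(t,k)}{\partial k^2}$ are continuous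 functions of $t\in(0,\infty)$. -/

import Mathlib

open MeasureTheory ProbabilityTheory Filter Topology
open scoped NNReal ENNReal

noncomputable section

/-- A real-valued Lévy process `X = (X_t)_{t ≥ 0}` on a probability space `(Ω, P)`: it starts at `0`
almost surely, has independent and stationary increments, and almost surely has càdlàg paths. -/
structure IsLevyProcess {Ω : Type*} [MeasurableSpace Ω] (X : ℝ≥0 → Ω → ℝ) (P : Measure Ω) :
    Prop where
  measurable : ∀ t, Measurable (X t)
  zero : ∀ᵐ ω ∂P, X 0 ω = 0
  indep_increments : HasIndepIncrements X P
  stationary_increments : ∀ s t : ℝ≥0, s ≤ t →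
    IdentDistrib (fun ω => X t ω - X s ω) (X (t - s)) P P
  cadlag : ∀ᵐ ω ∂P, ∀ t : ℝ≥0,
    ContinuousWithinAt (fun s => X s ω) (Set.Ici t) t ∧
      ∃ l : ℝ, Tendsto (fun s => X s ω) (𝓝[<] t) (𝓝 l)

/-- `ν` is a Lévy measure on `ℝ`: `ν({0}) = 0` and `∫ min(1, x²) ν(dx) < ∞`. -/
structure IsLevyMeasure (ν : Measure ℝ) : Prop where
  zero : ν {0} = 0
  lintegral_lt_top : ∫⁻ x, ENNReal.ofReal (min 1 (x ^ 2)) ∂ν < ∞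

/-- The Lévy–Khintchine exponent with drift `a`, Gaussian coefficient `σ` and Lévy measure `ν`,
`Ψ(z) = i a z - σ² z² / 2 + ∫ (e^{izx} - 1 - i z x 1_{|x| ≤ 1}) ν(dx)`. -/
def levyKhintchineExponent (a σ : ℝ) (ν : Measure ℝ) (z : ℝ) : ℂ :=
  Complex.I * a * z - (σ : ℂ) ^ 2 * (z : ℂ) ^ 2 / 2 +
    ∫ x : ℝ, (Complex.exp (Complex.I * z * x) - 1 -
      (if |x| ≤ 1 then Complex.I * z * x else 0)) ∂ν

/-- The process `X` has characteristic triplet `(a, σ, ν)`: `ν` is a Lévy measure, `0 ≤ σ`, and the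
characteristic function of `X_1` is the exponential of the Lévy–Khintchine exponent. -/
structure HasLevyTriplet {Ω : Type*} [MeasurableSpace Ω] (X : ℝ≥0 → Ω → ℝ) (P : Measure Ω)
    (a σ : ℝ) (ν : Measure ℝ) : Prop where
  isLevyMeasure : IsLevyMeasure ν
  nonneg : 0 ≤ σ
  charFun_eq : ∀ z : ℝ, charFun (P.map (X 1)) z = Complex.exp (levyKhintchineExponent a σ ν z)

/-- `X` has a first exponential moment: `E[e^{X_t}] < ∞` for all `t ≥ 0`. -/
def HasFirstExpMoment {Ω : Type*} [MeasurableSpace Ω] (X : ℝ≥0 → Ω → ℝ) (P : Measure Ω) : Prop :=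
  ∀ t : ℝ≥0, Integrable (fun ω => Real.exp (X t ω)) P

/-- `f(t, k) = E[(e^{X_t} - k)^+]`. -/
def callFunction {Ω : Type*} [MeasurableSpace Ω] (X : ℝ≥0 → Ω → ℝ) (P : Measure Ω)
    (t : ℝ≥0) (k : ℝ) : ℝ :=
  ∫ ω, max (Real.exp (X t ω) - k) 0 ∂P

/-- `p` is a continuous density of `μ` with respect to Lebesgue measure. There is at most one. -/
structure IsContinuousDensity (p : ℝ → ℝ) (μ : Measure ℝ) : Prop where
  continuous : Continuous p
  nonneg : ∀ x, 0 ≤ p x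
  eq_withDensity : μ = volume.withDensity (fun x => ENNReal.ofReal (p x))

end

/-! Independent stationary increments make `t ↦ charFun (P.map (X t)) z` multiplicative, and its
value at `t = 1` is bounded by `exp(-σ² z² / 2)`, since the jump part of the exponent has
nonpositive real part. Extracting an `n`-th root gives the bound `exp(-σ² z² / (2n))` for every `t ≥
1/n`. As `σ > 0`, this Gaussian yields both conclusions: Fourier inversion
(`isContinuousDensity_charFunDensity`) produces the continuous density, and dominated convergence
makes it continuous in `t`.

Since the law has no atoms, `E[(S - k)^+]` can be differentiated under the expectation; the
resulting tail `-P(X_t > log k)` is differentiated using the density. Its continuity in `t` is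
Lévy's continuity theorem, the half-line having a null boundary. -/

open scoped FourierTransform in
/-- The real part of the inverse Fourier transform of the characteristic function of `μ`. -/
noncomputable def charFunDensity (μ : Measure ℝ) (x : ℝ) : ℝ :=
  (𝓕 (fun ξ : ℝ => charFun μ (2 * Real.pi * ξ)) x).re

open scoped FourierTransform in
lemma charFunDensity_eq_integral (μ : Measure ℝ) (x : ℝ) :
    charFunDensity μ x =
      (∫ ξ : ℝ, Complex.exp ((-2 * Real.pi * ξ * x : ℝ) * Complex.I) *
        charFun μ (2 * Real.pi * ξ)).re := by
  rw [charFunDensity, Real.fourier_eq']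
  simp only [smul_eq_mul, RCLike.inner_apply, conj_trivial]
  congr! 6
  push_cast; ring

/-! ### Fourier inversion for finite measures with integrable characteristic function. -/

section Inversion

lemma integrable_charFun_two_pi_mul {μ : Measure ℝ} (h : Integrable (charFun μ)) :
    Integrable (fun ξ : ℝ => charFun μ (2 * Real.pi * ξ)) :=
  h.comp_mul_left' (by positivity)

open scoped FourierTransform in
lemma continuous_fourier_charFun {μ : Measure ℝ} (h : Integrable (charFun μ)) :
    Continuous (𝓕 (fun ξ : ℝ => charFun μ (2 * Real.pi * ξ))) :=
  VectorFourier.fourierIntegral_continuous Real.continuous_fourierChar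
    (L := innerₗ ℝ) continuous_inner (integrable_charFun_two_pi_mul h)

lemma continuous_charFunDensity {μ : Measure ℝ} (h : Integrable (charFun μ)) :
    Continuous (charFunDensity μ) :=
  Complex.continuous_re.comp (continuous_fourier_charFun h)

variable {μ : Measure ℝ} [IsFiniteMeasure μ]

-- Self-adjointness of the Fourier transform, used twice: pairing `𝓕 H` against `μ`, then against
-- Lebesgue measure. Both give `∫ 𝓕 H(ξ) * charFun μ (2πξ) dξ`.
open scoped FourierTransform in
lemma integral_schwartz_eq_integral_mul_fourier_charFun (h : Integrable (charFun μ))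
    (H : SchwartzMap ℝ ℂ) :
    ∫ x, H x ∂μ = ∫ x, H x * 𝓕 (fun ξ : ℝ => charFun μ (2 * Real.pi * ξ)) x := by
  -- The sign in `-innerₗ ℝ` turns the transform of `𝓕 H` back into `H`, and that of `1` against `μ`
  -- into the characteristic function.
  have e1 := VectorFourier.integral_fourierIntegral_smul_eq_flip (μ := (volume : Measure ℝ))
    (ν := μ) (L := -innerₗ ℝ) (f := (𝓕 H : SchwartzMap ℝ ℂ)) (g := fun _ => (1 : ℂ))
    Real.continuous_fourierChar (by simpa using! continuous_inner.neg)
    (𝓕 H : SchwartzMap ℝ ℂ).integrable (integrable_const _)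
  have e2 := VectorFourier.integral_fourierIntegral_smul_eq_flip (μ := (volume : Measure ℝ))
    (ν := volume) (L := innerₗ ℝ) (f := H) (g := fun ξ : ℝ => charFun μ (2 * Real.pi * ξ))
    Real.continuous_fourierChar continuous_inner
    H.integrable (integrable_charFun_two_pi_mul h)
  have e3 : ∀ x, VectorFourier.fourierIntegral Real.fourierChar (volume : Measure ℝ)
      (-innerₗ ℝ) (𝓕 H : SchwartzMap ℝ ℂ) x = H x := by
    intro x
    have : (𝓕⁻ (𝓕 H : SchwartzMap ℝ ℂ)) x = H x := by simp
    rw [← this, SchwartzMap.fourierInv_coe]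
    rfl
  have e4 : ∀ ξ, VectorFourier.fourierIntegral Real.fourierChar μ
      (-innerₗ ℝ).flip (fun _ => (1 : ℂ)) ξ = charFun μ (2 * Real.pi * ξ) := by
    intro ξ
    rw [charFun_apply_real]
    simp only [VectorFourier.fourierIntegral, Circle.smul_def, Real.fourierChar_apply',
      Circle.coe_exp]
    congr with x
    simp
    ring_nf
  have e5 : ∀ ξ, VectorFourier.fourierIntegral Real.fourierChar (volume : Measure ℝ)
      (innerₗ ℝ) H ξ = (𝓕 H : SchwartzMap ℝ ℂ) ξ := by
    intro ξ
    rw [SchwartzMap.fourier_coe]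
    rfl
  simp only [e3, e4, smul_eq_mul, mul_one] at e1
  simp only [e5, smul_eq_mul] at e2
  rw [e1, e2, flip_innerₗ]
  rfl

-- Against real test functions only the real part of the transform contributes.
open scoped FourierTransform ContDiff in
lemma integral_smul_eq_integral_smul_charFunDensity (h : Integrable (charFun μ))
    (g : ℝ → ℝ) (hg : ContDiff ℝ ∞ g) (hc : HasCompactSupport g) :
    ∫ x, g x ∂μ = ∫ x, g x * charFunDensity μ x := by
  have hg' : ContDiff ℝ ∞ (fun x => (g x : ℂ)) := Complex.ofRealCLM.contDiff.comp hg
  have hc' : HasCompactSupport (fun x => (g x : ℂ)) := hc.comp_left Complex.ofReal_zero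
  have key := integral_schwartz_eq_integral_mul_fourier_charFun h (hc'.toSchwartzMap hg')
  have hint : Integrable
      (fun x => (g x : ℂ) * 𝓕 (fun ξ : ℝ => charFun μ (2 * Real.pi * ξ)) x) :=
    (hg'.continuous.mul (continuous_fourier_charFun h)).integrable_of_hasCompactSupport
      hc'.mul_right
  have key' : ∫ x, (g x : ℂ) ∂μ =
      ∫ x, (g x : ℂ) * 𝓕 (fun ξ : ℝ => charFun μ (2 * Real.pi * ξ)) x := key
  have := congrArg Complex.re key'
  rw [integral_complex_ofReal, Complex.ofReal_re] at this
  rw [this]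
  change RCLike.re (K := ℂ) _ = _
  rw [← integral_re hint]
  congr with x
  simp [charFunDensity]

/-- Fourier inversion: a finite measure with integrable characteristic function has a continuous
density. -/
theorem isContinuousDensity_charFunDensity (h : Integrable (charFun μ)) :
    IsContinuousDensity (charFunDensity μ) μ := by
  have hcont := continuous_charFunDensity h
  set q := charFunDensity μ with hq
  -- Absolute continuity of `μ` is not yet known, so both measures are compared through densities
  -- with respect to one that dominates them.
  set m : Measure ℝ := μ + volume with hm
  have hμm : μ ≪ m := Measure.absolutelyContinuous_of_le (Measure.le_add_right le_rfl)
  have hvm : (volume : Measure ℝ) ≪ m :=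
    Measure.absolutelyContinuous_of_le (Measure.le_add_left le_rfl)
  have hfin : ∀ᵐ x ∂m, μ.rnDeriv m x < ∞ := Measure.rnDeriv_lt_top _ _
  have hgin : ∀ᵐ x ∂m, (volume : Measure ℝ).rnDeriv m x < ∞ := Measure.rnDeriv_lt_top _ _
  have hglob : LocallyIntegrable (fun x => ((volume : Measure ℝ).rnDeriv m x).toReal) m := by
    rw [locallyIntegrable_iff]
    intro K hK
    refine integrable_toReal_of_lintegral_ne_top (Measure.measurable_rnDeriv _ _).aemeasurable ?_
    rw [Measure.setLIntegral_rnDeriv hvm]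
    exact hK.measure_lt_top.ne
  have hae : ∀ᵐ x ∂m, (μ.rnDeriv m x).toReal =
      q x * ((volume : Measure ℝ).rnDeriv m x).toReal := by
    refine ae_eq_of_integral_contDiff_smul_eq
      Measure.integrable_toReal_rnDeriv.locallyIntegrable ?_ fun g hg hc => ?_
    · rw [locallyIntegrable_iff] at hglob ⊢
      intro K hK
      exact (hglob K hK).continuousOn_mul hcont.continuousOn hK
    · have e1 := integral_rnDeriv_smul hμm (f := g)
      have e2 := integral_rnDeriv_smul hvm (f := fun x => g x * q x)
      calc ∫ x, g x • (μ.rnDeriv m x).toReal ∂m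
          = ∫ x, (μ.rnDeriv m x).toReal • g x ∂m := by simp_rw [smul_eq_mul, mul_comm]
        _ = ∫ x, g x * q x := by
            rw [e1, integral_smul_eq_integral_smul_charFunDensity h g hg hc]
        _ = ∫ x, g x • (q x * ((volume : Measure ℝ).rnDeriv m x).toReal) ∂m := by
            rw [← e2]
            congr with x
            simp only [smul_eq_mul]; ring
  have hnn : ∀ x, 0 ≤ q x := by
    have hpos : ∀ᵐ x, 0 < (volume : Measure ℝ).rnDeriv m x := Measure.rnDeriv_pos hvm
    have hq0 : ∀ᵐ x, 0 ≤ q x := by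
      filter_upwards [hpos, hvm hgin, hvm hae] with x h1 h2 h3
      have : 0 < ((volume : Measure ℝ).rnDeriv m x).toReal := ENNReal.toReal_pos h1.ne' h2.ne
      have h4 : 0 ≤ q x * ((volume : Measure ℝ).rnDeriv m x).toReal := by
        rw [← h3]; exact ENNReal.toReal_nonneg
      exact nonneg_of_mul_nonneg_left h4 this
    -- A closed set of full Lebesgue measure is everything.
    have hd : Dense {x | 0 ≤ q x} := Measure.dense_of_ae hq0
    intro x
    have : closure {x | 0 ≤ q x} = {x | 0 ≤ q x} :=
      (isClosed_le continuous_const hcont).closure_eq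
    have hx := hd x
    rwa [this] at hx
  refine ⟨hcont, hnn, ?_⟩
  have hqm : Measurable fun x => ENNReal.ofReal (q x) := hcont.measurable.ennreal_ofReal
  calc μ = m.withDensity (μ.rnDeriv m) := (Measure.withDensity_rnDeriv_eq _ _ hμm).symm
    _ = m.withDensity ((volume : Measure ℝ).rnDeriv m * fun x => ENNReal.ofReal (q x)) := by
        refine withDensity_congr_ae ?_
        filter_upwards [hfin, hgin, hae] with x h1 h2 h3
        rw [Pi.mul_apply, ← ENNReal.ofReal_toReal h1.ne, h3, ENNReal.ofReal_mul (hnn x),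
          ENNReal.ofReal_toReal h2.ne, mul_comm]
    _ = (m.withDensity ((volume : Measure ℝ).rnDeriv m)).withDensity
          fun x => ENNReal.ofReal (q x) :=
        withDensity_mul _ (Measure.measurable_rnDeriv _ _) hqm
    _ = volume.withDensity fun x => ENNReal.ofReal (q x) := by
        rw [Measure.withDensity_rnDeriv_eq _ _ hvm]

end Inversion

/-! ### Decay and time continuity of the characteristic functions. -/

section LevyCharFun

/-- The integrand has real part `cos(zx) - 1 ≤ 0`, so jumps can only shrink the modulus. -/
lemma norm_exp_levyKhintchineExponent_le (a σ : ℝ) (ν : Measure ℝ) (z : ℝ) :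
    ‖Complex.exp (levyKhintchineExponent a σ ν z)‖ ≤ Real.exp (-(σ ^ 2 / 2) * z ^ 2) := by
  rw [Complex.norm_exp, Real.exp_le_exp, levyKhintchineExponent, Complex.add_re, Complex.sub_re]
  have h1 : (Complex.I * a * z : ℂ).re = 0 := by simp
  have h2 : ((σ : ℂ) ^ 2 * (z : ℂ) ^ 2 / 2).re = σ ^ 2 / 2 * z ^ 2 := by
    have : ((σ : ℂ) ^ 2 * (z : ℂ) ^ 2 / 2) = ((σ ^ 2 / 2 * z ^ 2 : ℝ) : ℂ) := by
      push_cast; ring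
    rw [this, Complex.ofReal_re]
  have h3 : (∫ x : ℝ, (Complex.exp (Complex.I * z * x) - 1 -
      (if |x| ≤ 1 then Complex.I * z * x else 0)) ∂ν).re ≤ 0 := by
    by_cases hint : Integrable (fun x : ℝ => Complex.exp (Complex.I * z * x) - 1 -
      (if |x| ≤ 1 then Complex.I * z * x else 0)) ν
    · change RCLike.re (K := ℂ) _ ≤ _
      rw [← integral_re hint]
      refine integral_nonpos fun x => ?_
      have e1 : (if |x| ≤ 1 then Complex.I * z * x else 0 : ℂ).re = 0 := by
        split_ifs <;> simp
      have e2 : (Complex.exp (Complex.I * z * x)).re = Real.cos (z * x) := by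
        rw [show Complex.I * z * x = ((z * x : ℝ) : ℂ) * Complex.I by push_cast; ring,
          Complex.exp_ofReal_mul_I_re]
      simp only [RCLike.re_to_complex, Complex.sub_re, Complex.one_re, e1, e2, Pi.zero_apply]
      linarith [Real.cos_le_one (z * x)]
    -- Without integrability the integral is `0` by convention, and the bound still holds.
    · rw [integral_undef hint, Complex.zero_re]
  rw [h1, h2]
  linarith

variable {Ω : Type*} [MeasurableSpace Ω] {P : Measure Ω} [IsProbabilityMeasure P]
  {X : ℝ≥0 → Ω → ℝ}

lemma IsLevyProcess.charFun_add (hX : IsLevyProcess X P) (s t : ℝ≥0) (z : ℝ) :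
    charFun (P.map (X (s + t))) z = charFun (P.map (X s)) z * charFun (P.map (X t)) z := by
  have hind : X s ⟂ᵢ[P] (X (s + t) - X s) :=
    hX.indep_increments.indepFun_eval_sub (zero_le (a := s)) le_self_add hX.zero
  have h := congrFun (hind.charFun_map_add_eq_mul (hX.measurable s).aemeasurable
    ((hX.measurable _).sub (hX.measurable s)).aemeasurable) z
  have hst := (hX.stationary_increments s (s + t) le_self_add).map_eq
  rw [add_tsub_cancel_left] at hst
  rw [add_sub_cancel, Pi.mul_apply] at h
  rw [h, ← hst]
  rfl

lemma IsLevyProcess.charFun_zero (hX : IsLevyProcess X P) (z : ℝ) :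
    charFun (P.map (X 0)) z = 1 := by
  have : X 0 =ᵐ[P] fun _ => (0 : ℝ) := hX.zero
  rw [Measure.map_congr this, Measure.map_const]
  simp

lemma IsLevyProcess.charFun_nsmul (hX : IsLevyProcess X P) (n : ℕ) (t : ℝ≥0) (z : ℝ) :
    charFun (P.map (X (n * t))) z = charFun (P.map (X t)) z ^ n := by
  induction n with
  | zero => simpa using hX.charFun_zero z
  | succ n ih => rw [Nat.cast_succ, add_mul, one_mul, hX.charFun_add, ih, pow_succ]

/-- At time `0` right-continuity of the paths is full continuity in `ℝ≥0`; this is the only use of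
càdlàg paths. -/
lemma IsLevyProcess.tendsto_charFun_zero (hX : IsLevyProcess X P) (z : ℝ) :
    Tendsto (fun t => charFun (P.map (X t)) z) (𝓝 0) (𝓝 1) := by
  have e : ∀ t, charFun (P.map (X t)) z = ∫ ω, Complex.exp (z * X t ω * Complex.I) ∂P := by
    intro t
    rw [charFun_apply_real, integral_map (hX.measurable t).aemeasurable]
    exact (by fun_prop : Continuous fun x : ℝ =>
      Complex.exp (z * x * Complex.I)).aestronglyMeasurable
  rw [← hX.charFun_zero z]
  simp_rw [e]
  refine tendsto_integral_filter_of_dominated_convergence (fun _ => 1) ?_ ?_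
    (integrable_const _) ?_
  · refine Eventually.of_forall fun t => Measurable.aestronglyMeasurable ?_
    have := hX.measurable t
    fun_prop
  · refine Eventually.of_forall fun t => Eventually.of_forall fun ω => ?_
    rw [← Complex.ofReal_mul, Complex.norm_exp_ofReal_mul_I]
  · filter_upwards [hX.cadlag] with ω hω
    have h0 := (hω 0).1
    rw [show Set.Ici (0 : ℝ≥0) = Set.univ from by ext; simp, continuousWithinAt_univ] at h0
    have hc : Continuous fun x : ℝ => Complex.exp (z * x * Complex.I) := by fun_prop
    exact (hc.tendsto _).comp h0.tendsto

/-- With truncated subtraction, `(s - t) + (t - s)` is `|s - t|`. Factoring out the characteristic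
function at the smaller time, of modulus at most `1`, reduces continuity everywhere to continuity at
`0`. -/
lemma IsLevyProcess.norm_charFun_sub_le (hX : IsLevyProcess X P) (s t : ℝ≥0) (z : ℝ) :
    ‖charFun (P.map (X s)) z - charFun (P.map (X t)) z‖ ≤
      ‖charFun (P.map (X ((s - t) + (t - s)))) z - 1‖ := by
  have hp : ∀ t, IsProbabilityMeasure (P.map (X t)) := fun t =>
    Measure.isProbabilityMeasure_map (hX.measurable t).aemeasurable
  wlog hst : s ≤ t generalizing s t
  · rw [norm_sub_rev, add_comm]
    exact this t s (le_of_not_ge hst)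
  rw [tsub_eq_zero_of_le hst, zero_add]
  conv_lhs => rw [← add_tsub_cancel_of_le hst, hX.charFun_add]
  rw [norm_sub_rev, ← mul_sub_one, norm_mul]
  exact mul_le_of_le_one_left (norm_nonneg _) (norm_charFun_le_one z)

lemma IsLevyProcess.continuous_charFun (hX : IsLevyProcess X P) (z : ℝ) :
    Continuous fun t => charFun (P.map (X t)) z := by
  refine continuous_iff_continuousAt.2 fun t => ?_
  refine tendsto_iff_norm_sub_tendsto_zero.2 ?_
  have h0 : Tendsto (fun s : ℝ≥0 => (s - t) + (t - s)) (𝓝 t) (𝓝 0) := by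
    have : Continuous fun s : ℝ≥0 => (s - t) + (t - s) := by fun_prop
    simpa using this.tendsto t
  have h1 : Tendsto (fun s : ℝ≥0 => ‖charFun (P.map (X ((s - t) + (t - s)))) z - 1‖)
      (𝓝 t) (𝓝 0) := by
    simpa using (((hX.tendsto_charFun_zero z).comp h0).sub_const 1).norm
  exact squeeze_zero (fun _ => norm_nonneg _) (fun s => hX.norm_charFun_sub_le s t z) h1

variable {a σ : ℝ} {ν : Measure ℝ}

lemma IsLevyProcess.norm_charFun_le_exp (hX : IsLevyProcess X P)
    (htriplet : HasLevyTriplet X P a σ ν) {n : ℕ} (hn : n ≠ 0) {t : ℝ≥0}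
    (ht : (n : ℝ≥0)⁻¹ ≤ t) (z : ℝ) :
    ‖charFun (P.map (X t)) z‖ ≤ Real.exp (-(σ ^ 2 / (2 * n)) * z ^ 2) := by
  have hp : ∀ t, IsProbabilityMeasure (P.map (X t)) := fun t =>
    Measure.isProbabilityMeasure_map (hX.measurable t).aemeasurable
  have hn' : (n : ℝ) ≠ 0 := Nat.cast_ne_zero.2 hn
  rw [← add_tsub_cancel_of_le ht, hX.charFun_add, norm_mul]
  -- The factor from the time beyond `1/n` has modulus at most `1`; the factor at `1/n` has `n`-th
  -- power equal to the value at time `1`.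
  refine (mul_le_of_le_one_right (norm_nonneg _) (norm_charFun_le_one z)).trans ?_
  have h1 : ‖charFun (P.map (X (n : ℝ≥0)⁻¹)) z‖ ^ n ≤
      Real.exp (-(σ ^ 2 / (2 * n)) * z ^ 2) ^ n := by
    rw [← norm_pow, ← hX.charFun_nsmul, mul_inv_cancel₀ (Nat.cast_ne_zero.2 hn),
      htriplet.charFun_eq, ← Real.exp_nat_mul]
    refine (norm_exp_levyKhintchineExponent_le a σ ν z).trans_eq ?_
    congr 1
    field_simp
  exact le_of_pow_le_pow_left₀ hn (Real.exp_pos _).le h1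

lemma IsLevyProcess.integrable_charFun (hX : IsLevyProcess X P)
    (htriplet : HasLevyTriplet X P a σ ν) (hσ : 0 < σ) {t : ℝ≥0} (ht : 0 < t) :
    Integrable (charFun (P.map (X t))) := by
  have hp : IsProbabilityMeasure (P.map (X t)) :=
    Measure.isProbabilityMeasure_map (hX.measurable t).aemeasurable
  obtain ⟨n, hn⟩ := exists_nat_one_div_lt ht
  rw [one_div, ← Nat.cast_succ] at hn
  refine (integrable_exp_neg_mul_sq (b := σ ^ 2 / (2 * (n.succ : ℕ))) (by positivity)).mono'
    stronglyMeasurable_charFun.aestronglyMeasurable (Eventually.of_forall fun z => ?_)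
  exact hX.norm_charFun_le_exp htriplet n.succ_ne_zero hn.le z

end LevyCharFun

/-! ### Tails of a measure with continuous density. -/

section Density

variable {μ : Measure ℝ} {p : ℝ → ℝ}

lemma IsContinuousDensity.absolutelyContinuous (h : IsContinuousDensity p μ) : μ ≪ volume := by
  rw [h.eq_withDensity]
  exact withDensity_absolutelyContinuous _ _

lemma IsContinuousDensity.measureReal_Ioc (h : IsContinuousDensity p μ) {x y : ℝ} (hxy : x ≤ y) :
    μ.real (Set.Ioc x y) = ∫ u in x..y, p u := by
  rw [measureReal_def, h.eq_withDensity, withDensity_apply _ measurableSet_Ioc,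
    intervalIntegral.integral_of_le hxy,
    integral_eq_lintegral_of_nonneg_ae (Eventually.of_forall h.nonneg)
      h.continuous.aestronglyMeasurable]

variable [IsFiniteMeasure μ]

lemma IsContinuousDensity.measureReal_Ioi (h : IsContinuousDensity p μ) (x y : ℝ) :
    μ.real (Set.Ioi y) = μ.real (Set.Ioi x) - ∫ u in x..y, p u := by
  wlog hxy : x ≤ y generalizing x y
  · rw [this y x (le_of_not_ge hxy), intervalIntegral.integral_symm]
    ring
  rw [← h.measureReal_Ioc hxy, ← Set.Ioc_union_Ioi_eq_Ioi hxy,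
    measureReal_union (Set.Ioc_disjoint_Ioi le_rfl) measurableSet_Ioi]
  ring

lemma IsContinuousDensity.hasDerivAt_measureReal_Ioi (h : IsContinuousDensity p μ) (x : ℝ) :
    HasDerivAt (fun y => μ.real (Set.Ioi y)) (-p x) x := by
  have h1 : HasDerivAt (fun y => ∫ u in x..y, p u) (p x) x :=
    intervalIntegral.integral_hasDerivAt_right (h.continuous.intervalIntegrable _ _)
      (h.continuous.stronglyMeasurableAtFilter _ _) h.continuous.continuousAt
  simpa only [← h.measureReal_Ioi x] using h1.const_sub (μ.real (Set.Ioi x))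

end Density

/-! ### Differentiating the call payoff in the strike. -/

section Call

variable {Ω : Type*} [MeasurableSpace Ω] {P : Measure Ω} [IsProbabilityMeasure P]

/-- If `S` is integrable without atom at `k`, then `k ↦ E[(S - k)^+]` has derivative `-P(S > k)`. -/
lemma hasDerivAt_integral_max_sub_zero {S : Ω → ℝ} (hm : Measurable S) (hS : Integrable S P)
    {k : ℝ} (hk : ∀ᵐ ω ∂P, S ω ≠ k) :
    HasDerivAt (fun k => ∫ ω, max (S ω - k) 0 ∂P) (-(P.real {ω | k < S ω})) k := by
  have hset : MeasurableSet {ω | k < S ω} := measurableSet_lt measurable_const hm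
  have hval : ∫ ω, ({ω | k < S ω}.indicator (fun _ => (-1 : ℝ))) ω ∂P = -P.real {ω | k < S ω} := by
    rw [integral_indicator_const _ hset]
    simp
  rw [← hval]
  refine (hasDerivAt_integral_of_dominated_loc_of_lip (bound := fun _ => 1) univ_mem
    (Eventually.of_forall fun k => ?_) ?_ ?_ ?_ (integrable_const _) ?_).2
  · exact ((hm.sub_const k).max measurable_const).aestronglyMeasurable
  · exact (hS.sub (integrable_const k)).pos_part
  · exact (measurable_const.indicator hset).aestronglyMeasurable
  -- The payoff is 1-Lipschitz in the strike, so the constant `1` dominates the difference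
  -- quotients.
  · refine Eventually.of_forall fun ω => LipschitzOnWith.of_dist_le_mul fun x _ y _ => ?_
    simp only [map_one, NNReal.coe_one, one_mul, Real.dist_eq]
    refine (abs_max_sub_max_le_abs _ _ _).trans_eq ?_
    rw [← abs_neg]
    congr 1
    ring
  · filter_upwards [hk] with ω hω
    rcases lt_or_gt_of_ne hω with h | h
    · have : (fun x => max (S ω - x) 0) =ᶠ[𝓝 k] fun _ => 0 := by
        filter_upwards [lt_mem_nhds h] with x hx
        exact max_eq_right (by linarith)
      rw [Set.indicator_of_notMem (by simpa using h.le)]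
      exact (hasDerivAt_const k (0 : ℝ)).congr_of_eventuallyEq this
    · have : (fun x => max (S ω - x) 0) =ᶠ[𝓝 k] fun x => S ω - x := by
        filter_upwards [gt_mem_nhds h] with x hx
        exact max_eq_left (by linarith)
      rw [Set.indicator_of_mem (by exact h)]
      exact ((hasDerivAt_id k).const_sub (S ω)).congr_of_eventuallyEq this

end Call

/-! ### Application to the Lévy process. -/

section Levy

variable {Ω : Type*} [MeasurableSpace Ω] {P : Measure Ω}
  {X : ℝ≥0 → Ω → ℝ} {a σ : ℝ} {ν : Measure ℝ}

lemma IsLevyProcess.measureReal_lt_exp (hX : IsLevyProcess X P) (t : ℝ≥0) {k : ℝ} (hk : 0 < k) :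
    P.real {ω | k < Real.exp (X t ω)} = (P.map (X t)).real (Set.Ioi (Real.log k)) := by
  rw [map_measureReal_apply (hX.measurable t) measurableSet_Ioi]
  congr 1
  ext ω
  exact (Real.log_lt_iff_lt_exp hk).symm

variable [IsProbabilityMeasure P]

lemma IsLevyProcess.isContinuousDensity (hX : IsLevyProcess X P)
    (htriplet : HasLevyTriplet X P a σ ν) (hσ : 0 < σ) {t : ℝ≥0} (ht : 0 < t) :
    IsContinuousDensity (charFunDensity (P.map (X t))) (P.map (X t)) :=
  have := Measure.isProbabilityMeasure_map (μ := P) (hX.measurable t).aemeasurable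
  isContinuousDensity_charFunDensity (hX.integrable_charFun htriplet hσ ht)

lemma IsLevyProcess.continuousAt_charFunDensity (hX : IsLevyProcess X P)
    (htriplet : HasLevyTriplet X P a σ ν) (hσ : 0 < σ) {t : ℝ≥0} (ht : 0 < t) (x : ℝ) :
    ContinuousAt (fun t => charFunDensity (P.map (X t)) x) t := by
  simp only [charFunDensity_eq_integral]
  refine Complex.continuous_re.continuousAt.comp ?_
  obtain ⟨n, hn⟩ := exists_nat_one_div_lt ht
  rw [one_div, ← Nat.cast_succ] at hn
  have hint : Integrable fun z : ℝ => Real.exp (-(σ ^ 2 / (2 * (n.succ : ℕ))) * z ^ 2) :=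
    integrable_exp_neg_mul_sq (by positivity)
  refine continuousAt_of_dominated ?_ ?_
    (hint.comp_mul_left' (R := 2 * Real.pi) (by positivity)) ?_
  · refine Eventually.of_forall fun s => ?_
    have := Measure.isProbabilityMeasure_map (μ := P) (hX.measurable s).aemeasurable
    have h1 : Measurable (charFun (P.map (X s))) := measurable_charFun
    fun_prop
  -- One `n` with `1/n < t` serves all times near `t`, giving a single Gaussian majorant.
  · filter_upwards [lt_mem_nhds hn] with s hs
    refine Eventually.of_forall fun z => ?_
    rw [norm_mul, Complex.norm_exp_ofReal_mul_I, one_mul]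
    exact hX.norm_charFun_le_exp htriplet n.succ_ne_zero hs.le _
  · exact Eventually.of_forall fun z =>
      (continuous_const.mul (hX.continuous_charFun _)).continuousAt

lemma IsLevyProcess.continuousAt_measureReal_Ioi (hX : IsLevyProcess X P) {t : ℝ≥0} {x : ℝ}
    (hx : P.map (X t) {x} = 0) :
    ContinuousAt (fun t => (P.map (X t)).real (Set.Ioi x)) t := by
  let M : ℝ≥0 → ProbabilityMeasure ℝ := fun t =>
    ⟨P.map (X t), Measure.isProbabilityMeasure_map (hX.measurable t).aemeasurable⟩
  -- Along sequences, Lévy's continuity theorem gives weak convergence; the portmanteau theorem then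
  -- applies because the frontier `{x}` is null.
  refine tendsto_of_seq_tendsto fun u hu => ?_
  have h1 : Tendsto (fun n => M (u n)) atTop (𝓝 (M t)) :=
    ProbabilityMeasure.tendsto_of_tendsto_charFun fun z =>
      ((hX.continuous_charFun z).tendsto t).comp hu
  have h2 := ProbabilityMeasure.tendsto_measure_of_null_frontier_of_tendsto' h1
    (E := Set.Ioi x) (by rw [frontier_Ioi]; exact hx)
  exact (ENNReal.tendsto_toReal (measure_ne_top _ _)).comp h2

lemma IsLevyProcess.hasDerivAt_callFunction (hX : IsLevyProcess X P)
    (hexp : HasFirstExpMoment X P) {t : ℝ≥0} {k : ℝ}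
    (h0 : P.map (X t) {Real.log k} = 0) :
    HasDerivAt (callFunction X P t) (-(P.real {ω | k < Real.exp (X t ω)})) k := by
  refine hasDerivAt_integral_max_sub_zero (Real.measurable_exp.comp (hX.measurable t)) (hexp t) ?_
  rw [Measure.map_apply (hX.measurable t) (measurableSet_singleton _)] at h0
  filter_upwards [measure_eq_zero_iff_ae_notMem.1 h0] with ω hω h
  exact hω (by simp [← h])

lemma IsLevyProcess.hasDerivAt_deriv_callFunction (hX : IsLevyProcess X P)
    (hexp : HasFirstExpMoment X P) {t : ℝ≥0} {p : ℝ → ℝ}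
    (hp : IsContinuousDensity p (P.map (X t))) {k : ℝ} (hk : 0 < k) :
    HasDerivAt (deriv (callFunction X P t)) (p (Real.log k) / k) k := by
  have hfin := Measure.isProbabilityMeasure_map (μ := P) (hX.measurable t).aemeasurable
  have h1 := ((hp.hasDerivAt_measureReal_Ioi (Real.log k)).comp k
    (Real.hasDerivAt_log hk.ne')).neg
  rw [neg_mul, neg_neg, ← div_eq_mul_inv] at h1
  refine h1.congr_of_eventuallyEq ?_
  filter_upwards [lt_mem_nhds hk] with x hx
  rw [(hX.hasDerivAt_callFunction hexp (hp.absolutelyContinuous (by simp))).deriv,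
    hX.measureReal_lt_exp t hx]
  rfl

end Levy

theorem propositionA1 {Ω : Type*} [MeasurableSpace Ω] (P : Measure Ω) [IsProbabilityMeasure P]
    (X : ℝ≥0 → Ω → ℝ) (hX : IsLevyProcess X P)
    (a σ : ℝ) (ν : Measure ℝ) (htriplet : HasLevyTriplet X P a σ ν)
    (hexp : HasFirstExpMoment X P) (hσ : 0 < σ) :
    ∃ p : ℝ≥0 → ℝ → ℝ,
      (∀ t : ℝ≥0, 0 < t → IsContinuousDensity (p t) (P.map (X t))) ∧
      (∀ t : ℝ≥0, 0 < t → ∀ k : ℝ, 0 < k →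
        HasDerivAt (callFunction X P t) (-(P.real {ω | k < Real.exp (X t ω)})) k ∧
        HasDerivAt (deriv (callFunction X P t)) (p t (Real.log k) / k) k) ∧
      (∀ k : ℝ, 0 < k →
        ContinuousOn (fun t : ℝ≥0 => deriv (callFunction X P t) k) (Set.Ioi 0) ∧
        ContinuousOn (fun t : ℝ≥0 => deriv (deriv (callFunction X P t)) k) (Set.Ioi 0)) := by
  have hp : ∀ t : ℝ≥0, 0 < t →
      IsContinuousDensity (charFunDensity (P.map (X t))) (P.map (X t)) :=
    fun t ht => hX.isContinuousDensity htriplet hσ ht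
  have h0 : ∀ t : ℝ≥0, 0 < t → ∀ x : ℝ, P.map (X t) {x} = 0 :=
    fun t ht x => (hp t ht).absolutelyContinuous (by simp)
  refine ⟨fun t => charFunDensity (P.map (X t)), hp, fun t ht k hk =>
    ⟨hX.hasDerivAt_callFunction hexp (h0 t ht _),
      hX.hasDerivAt_deriv_callFunction hexp (hp t ht) hk⟩, fun k hk => ⟨?_, ?_⟩⟩
  · have : ContinuousOn (fun t => -(P.map (X t)).real (Set.Ioi (Real.log k))) (Set.Ioi 0) :=
      fun t ht => (hX.continuousAt_measureReal_Ioi (h0 t ht _)).neg.continuousWithinAt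
    refine this.congr fun t ht => ?_
    rw [(hX.hasDerivAt_callFunction hexp (h0 t ht _)).deriv, hX.measureReal_lt_exp t hk]
  · have : ContinuousOn (fun t => charFunDensity (P.map (X t)) (Real.log k) / k) (Set.Ioi 0) :=
      fun t ht => ((hX.continuousAt_charFunDensity htriplet hσ ht _).div_const k).continuousWithinAt
    exact this.congr fun t ht => (hX.hasDerivAt_deriv_callFunction hexp (hp t ht) hk).deriv
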